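/- Let $k\in\{1,\dots,n-1\}$ and let $H\subset\mathbb R^n$ be a linear subspace of dimension $n-k$, with orthogonal projection $P_H$ onto $H$ and orthogonal complement $H^\perp$. For $f:\mathbb R^n\to[0,\infty)$ write $\|f\|_\infty=\operatorname{ess\,sup}_{x\in\mathbb R^n}f(x)$ (with respect to Lebesgue measure), $\mathcal C_t(f)=\{x\in\operatorname{supp}f: f(x)\ge t\|f\|_\infty\}$, where $\operatorname{supp}f$ is the closure of $\{f>0\}$, and $P_Hf(x)=\sup_{y\in H^\perp}f(x+y)$ for $x\in H$. Let $f:\mathbb R^n\to[0,\infty)$ be a bounded quasi-concave function (that is, $f((1-\lambda)x+\lambda y)\ge\min\{f(x),f(y)\}$ for all $x,y\in\mathbb R^n$, $\lambda\in(0,1)$) such that, for every $t\in(0,1)$, the $k$-dimensional volume $\mathrm{vol}_k\bigl(\mathcal C_t(f)\cap(x+H^\perp)\bigr)$, $x\in H$, attains its maximum at $x=0$. Assume that $\|f\|_\infty$ also bounds $f$ on $H^\perp$ and $P_Hf$ on $H$ up to null sets, i.e. $f(y)\le\|f\|_\infty$ for almost every $y\in H^\perp$ and $P_Hf(x)\le\|f\|_\infty$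 for almost every $x\in H$ (this holds, in particular, whenever $\sup f=\|f\|_\infty$). Let $g:H\to[0,\infty)$ be (Lebesgue) measurable and radially decreasing, i.e. $g(tx)\ge g(x)$ for all $t\in[0,1]$ and $x\in H$. Then $$\int_H g(x)\,P_Hf(x)\,dx\int_{H^\perp}f(y)\,dy\le\binom nk\,\|f\|_\infty\int_{\mathbb R^n}g(P_Hx)\,f(x)\,dx,$$ where the integrals take values in $[0,\infty]$ and $0\cdot\infty=0$. -/

import Mathlib

open MeasureTheory Set
open scoped NNReal ENNReal

noncomputable section

/-- The norm `‖f‖_∞`: the essential supremum of `f : ℝⁿ → [0, ∞)` for Lebesgue measure. -/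
def supNorm {n : ℕ} (f : EuclideanSpace ℝ (Fin n) → ℝ≥0) : ℝ≥0 :=
  essSup f volume

/-- The superlevel set `C_t(f) = {x ∈ supp f : f x ≥ t ‖f‖_∞}`, where `supp f` is the closure of
`{x : f x > 0}`. -/
def superlevel {n : ℕ} (f : EuclideanSpace ℝ (Fin n) → ℝ≥0) (t : ℝ) :
    Set (EuclideanSpace ℝ (Fin n)) :=
  {x | x ∈ tsupport f ∧ t * (supNorm f : ℝ) ≤ (f x : ℝ)}

/-- The volume of the section `A ∩ (x + Hᗮ)`: Lebesgue measure on the Euclidean space `Hᗮ` of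
`{y ∈ Hᗮ : x + y ∈ A}`. -/
def sectionVolume {n : ℕ} (H : Submodule ℝ (EuclideanSpace ℝ (Fin n)))
    (A : Set (EuclideanSpace ℝ (Fin n))) (x : H) : ℝ≥0∞ :=
  volume {y : Hᗮ | (x : EuclideanSpace ℝ (Fin n)) + (y : EuclideanSpace ℝ (Fin n)) ∈ A}

/-- The projection `P_H f : H → [0, ∞)`, `P_H f x = sup_{y ∈ Hᗮ} f (x + y)`
(meaningful for bounded `f`). -/
def projFun {n : ℕ} (H : Submodule ℝ (EuclideanSpace ℝ (Fin n)))
    (f : EuclideanSpace ℝ (Fin n) → ℝ≥0) (x : H) : ℝ≥0 :=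
  ⨆ y : Hᗮ, f ((x : EuclideanSpace ℝ (Fin n)) + (y : EuclideanSpace ℝ (Fin n)))

/-- `g` is radially decreasing: `g (t x) ≥ g x` for all `t ∈ [0, 1]` and all `x`. -/
def RadiallyDecreasing {E : Type*} [AddCommGroup E] [Module ℝ E] (g : E → ℝ≥0) : Prop :=
  ∀ t ∈ Icc (0 : ℝ) 1, ∀ x : E, g x ≤ g (t • x)

end

/-! Slice `f` by its superlevel sets `K = {f > r}`, which are convex. If `x` lies in the projection
of `K` to `H`, convexity puts a translate of `(1 - l)(K ∩ Hᗮ)` in the fibre of `K` over `l • x`, so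
that fibre has volume at least `(1 - l)^k` times the central one. Averaging over `l` with density `k
(1 - l)^(k-1)`, substituting `w = l • u` and using `g (l • u) ≥ g u` leaves the Beta integral `∫ k
(1 - l)^(k-1) l^(n-k) = 1 / (n choose k)`. This is the inequality for one level
(`Convex.mul_sectionVolume_zero_le`). Both factors on the left are layer-cake integrals over `(0,
‖f‖_∞)` of functions decreasing in the level, so Chebyshev's inequality
(`lintegral_mul_lintegral_le_of_antitone`) bounds their product by `‖f‖_∞` times the integral of the
levelwise products. -/

/-! ### Beta integrals -/

theorem integral_succ_mul_one_sub_pow_mul_pow (m j : ℕ) :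
    ∫ x in (0 : ℝ)..1, ((j + 1 : ℝ) * (1 - x) ^ j) * x ^ m
      = ((m + (j + 1)).choose (j + 1) : ℝ)⁻¹ := by
  have hd : ∀ (j : ℕ) (x : ℝ),
      HasDerivAt (fun x : ℝ => -(1 - x) ^ (j + 1)) ((j + 1 : ℝ) * (1 - x) ^ j) x := by
    intro j x
    have h := (((hasDerivAt_id x).const_sub 1).pow (j + 1)).neg
    convert! h using 1
    simp
  induction m generalizing j with
  | zero =>
    have := intervalIntegral.integral_eq_sub_of_hasDerivAt (a := 0) (b := 1)
      (fun x _ => hd j x) (Continuous.intervalIntegrable (by fun_prop) _ _)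
    simp only [pow_zero, mul_one, this]
    simp
  -- Integration by parts trades one power of `x` for one of `1 - x`, so the induction hypothesis is
  -- needed at `j + 1`.
  | succ m ih =>
    have h := intervalIntegral.integral_deriv_mul_eq_sub (a := (0 : ℝ)) (b := 1)
      (u := fun x : ℝ => -(1 - x) ^ (j + 1)) (v := fun x : ℝ => x ^ (m + 1))
      (u' := fun x : ℝ => (j + 1 : ℝ) * (1 - x) ^ j) (v' := fun x : ℝ => (m + 1 : ℝ) * x ^ m)
      (fun x _ => hd j x)
      (fun x _ => by simpa using hasDerivAt_pow (m + 1) x)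
      (Continuous.intervalIntegrable (by fun_prop) _ _)
      (Continuous.intervalIntegrable (by fun_prop) _ _)
    rw [intervalIntegral.integral_add (Continuous.intervalIntegrable (by fun_prop) _ _)
      (Continuous.intervalIntegrable (by fun_prop) _ _)] at h
    have h2 : ∫ x in (0 : ℝ)..1, -(1 - x) ^ (j + 1) * ((m + 1 : ℝ) * x ^ m)
        = -((m + 1 : ℝ) / (j + 2)) *
          ∫ x in (0 : ℝ)..1, (((j + 1 : ℕ) + 1 : ℝ) * (1 - x) ^ (j + 1)) * x ^ m := by
      rw [← intervalIntegral.integral_const_mul]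
      congr 1
      ext x
      push_cast
      field_simp
      ring
    rw [h2, ih (j + 1)] at h
    have hc := Nat.choose_succ_right_eq (m + 1 + (j + 1)) (j + 1)
    rw [Nat.add_sub_cancel, show m + 1 + (j + 1) = m + (j + 1 + 1) by ring] at hc
    have hc' : (((m + (j + 1 + 1)).choose (j + 1 + 1) : ℕ) : ℝ) * (j + 2)
        = ((m + (j + 1 + 1)).choose (j + 1) : ℕ) * (m + 1) := by
      have : ((_ : ℕ) : ℝ) = _ := congrArg Nat.cast hc
      push_cast at this
      linarith
    have p1 : (0 : ℝ) < ((m + (j + 1 + 1)).choose (j + 1 + 1) : ℕ) := by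
      exact_mod_cast Nat.choose_pos (by omega)
    have p2 : (0 : ℝ) < ((m + (j + 1 + 1)).choose (j + 1) : ℕ) := by
      exact_mod_cast Nat.choose_pos (by omega)
    rw [show m + 1 + (j + 1) = m + (j + 1 + 1) by ring]
    have h3 : ∫ x in (0 : ℝ)..1, ((j + 1 : ℝ) * (1 - x) ^ j) * x ^ (m + 1)
        = ((m + 1 : ℝ) / (j + 2)) * ((m + (j + 1 + 1)).choose (j + 1 + 1) : ℝ)⁻¹ := by
      simp at h
      linarith
    rw [h3]
    field_simp
    linarith

theorem lintegral_Ioo_succ_mul_one_sub_pow_mul_pow (m j : ℕ) :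
    ∫⁻ x in Ioo (0 : ℝ) 1, ENNReal.ofReal ((j + 1 : ℝ) * (1 - x) ^ j) * ENNReal.ofReal (x ^ m)
      = ((m + (j + 1)).choose (j + 1) : ℝ≥0∞)⁻¹ := by
  have h := integral_succ_mul_one_sub_pow_mul_pow m j
  rw [intervalIntegral.integral_of_le zero_le_one, integral_Ioc_eq_integral_Ioo] at h
  have hpos : (0 : ℝ) < ((m + (j + 1)).choose (j + 1) : ℕ) := by
    exact_mod_cast Nat.choose_pos (by omega)
  rw [← ENNReal.ofReal_natCast, ← ENNReal.ofReal_inv_of_pos hpos, ← h,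
    ofReal_integral_eq_lintegral_ofReal]
  · refine setLIntegral_congr_fun measurableSet_Ioo fun x hx => ?_
    have : 0 ≤ 1 - x := by linarith [hx.2]
    exact (ENNReal.ofReal_mul (by positivity)).symm
  · exact (Continuous.integrableOn_Icc (by fun_prop)).mono_set Ioo_subset_Icc_self
  · filter_upwards [ae_restrict_mem measurableSet_Ioo] with x hx
    have : 0 ≤ 1 - x := by linarith [hx.2]
    have := hx.1.le
    simp only [Pi.zero_apply]
    positivity

theorem lintegral_Icc_succ_mul_one_sub_pow {a : ℝ} (ha : a ≤ 1) (j : ℕ) :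
    ∫⁻ x in Icc a 1, ENNReal.ofReal ((j + 1 : ℝ) * (1 - x) ^ j)
      = ENNReal.ofReal ((1 - a) ^ (j + 1)) := by
  have h : ∫ x in a..1, (j + 1 : ℝ) * (1 - x) ^ j = (1 - a) ^ (j + 1) := by
    rw [intervalIntegral.integral_eq_sub_of_hasDerivAt
      (f := fun x : ℝ => -(1 - x) ^ (j + 1)) _ (Continuous.intervalIntegrable (by fun_prop) _ _)]
    · simp
    · intro x _
      convert! (((hasDerivAt_id x).const_sub 1).pow (j + 1)).neg using 1
      simp
  rw [← h, intervalIntegral.integral_of_le ha, ← integral_Icc_eq_integral_Ioc,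
    ofReal_integral_eq_lintegral_ofReal]
  · exact Continuous.integrableOn_Icc (by fun_prop)
  · filter_upwards [ae_restrict_mem measurableSet_Icc] with x hx
    have : 0 ≤ 1 - x := by linarith [hx.2]
    simp only [Pi.zero_apply]
    positivity

/-- By continuity the hypothesis persists at `a = sInf Λ`. Since `Λ ⊆ [a, 1]`, where the density has
integral `(1 - a)^(j+1)`, no structure of `Λ` is needed. -/
theorem setLIntegral_mul_le_of_one_sub_pow_mul_le {Λ : Set ℝ} (hΛ : Λ ⊆ Ioo 0 1) (j : ℕ)
    {b S : ℝ≥0∞} (h : ∀ l ∈ Λ, ENNReal.ofReal ((1 - l) ^ (j + 1)) * b ≤ S) :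
    (∫⁻ l in Λ, ENNReal.ofReal ((j + 1 : ℝ) * (1 - l) ^ j)) * b ≤ S := by
  rcases Λ.eq_empty_or_nonempty with rfl | ⟨c, hc⟩
  · simp
  have hbdd : BddBelow Λ := ⟨0, fun l hl => (hΛ hl).1.le⟩
  have ha : sInf Λ < 1 := (csInf_le hbdd hc).trans_lt (hΛ hc).2
  have hsub : Λ ⊆ Icc (sInf Λ) 1 := fun l hl => ⟨csInf_le hbdd hl, (hΛ hl).2.le⟩
  obtain ⟨u, hu, hlim⟩ := mem_closure_iff_seq_limit.1 (csInf_mem_closure ⟨c, hc⟩ hbdd)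
  have hcont : Continuous fun l : ℝ => ENNReal.ofReal ((1 - l) ^ (j + 1)) :=
    ENNReal.continuous_ofReal.comp (by fun_prop)
  -- Multiplication by `b` must be continuous at the limit even when `b = ⊤`.
  have hne : ENNReal.ofReal ((1 - sInf Λ) ^ (j + 1)) ≠ 0 := by
    have : 0 < 1 - sInf Λ := by linarith
    simpa using by positivity
  have hS : ENNReal.ofReal ((1 - sInf Λ) ^ (j + 1)) * b ≤ S :=
    le_of_tendsto' (ENNReal.Tendsto.mul_const ((hcont.tendsto _).comp hlim) (Or.inl hne))
      fun i => h _ (hu i)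
  refine le_trans ?_ hS
  rw [← lintegral_Icc_succ_mul_one_sub_pow ha.le]
  gcongr

/-! ### Chebyshev's integral inequality -/

/-- Integrate `(A t - A u)(B t - B u) ≥ 0` over `s × s`, written without subtraction. -/
theorem lintegral_mul_lintegral_le_of_antitone {A B : ℝ → ℝ≥0∞} (hA : Antitone A)
    (hB : Antitone B) (s : Set ℝ) :
    (∫⁻ t in s, A t) * ∫⁻ t in s, B t ≤ volume s * ∫⁻ t in s, A t * B t := by
  have key : ∀ t u, A t * B u + A u * B t ≤ A t * B t + A u * B u := by
    have aux : ∀ t u, t ≤ u → A t * B u + A u * B t ≤ A t * B t + A u * B u := by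
      intro t u htu
      obtain ⟨a, ha⟩ := exists_add_of_le (hA htu)
      obtain ⟨b, hb⟩ := exists_add_of_le (hB htu)
      rw [ha, hb]
      calc _ ≤ (A u + a) * B u + A u * (B u + b) + a * b := le_self_add
        _ = _ := by ring
    intro t u
    rcases le_total t u with h | h
    · exact aux t u h
    · have := aux u t h
      rwa [add_comm (A u * B t), add_comm (A u * B u)] at this
  have hAm := hA.measurable
  have hBm := hB.measurable
  have hI : ∫⁻ t in s, ∫⁻ u in s, (A t * B u + A u * B t)
      ≤ ∫⁻ t in s, ∫⁻ u in s, (A t * B t + A u * B u) :=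
    lintegral_mono fun t => lintegral_mono fun u => key t u
  have e1 : ∫⁻ t in s, ∫⁻ u in s, (A t * B u + A u * B t)
      = 2 * ((∫⁻ t in s, A t) * ∫⁻ t in s, B t) := by
    have : ∀ t, ∫⁻ u in s, (A t * B u + A u * B t)
        = A t * (∫⁻ u in s, B u) + (∫⁻ u in s, A u) * B t := by
      intro t
      rw [lintegral_add_left (by fun_prop), lintegral_const_mul _ hBm, lintegral_mul_const _ hAm]
    simp_rw [this]
    rw [lintegral_add_left (by fun_prop), lintegral_const_mul _ hBm, lintegral_mul_const _ hAm]
    ring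
  have e2 : ∫⁻ t in s, ∫⁻ u in s, (A t * B t + A u * B u)
      = 2 * (volume s * ∫⁻ t in s, A t * B t) := by
    have : ∀ t, ∫⁻ u in s, (A t * B t + A u * B u)
        = A t * B t * volume s + ∫⁻ u in s, A u * B u := by
      intro t
      rw [lintegral_add_left (by fun_prop)]
      simp
    simp_rw [this]
    rw [lintegral_add_left (by fun_prop), lintegral_mul_const _ (by fun_prop)]
    simp
    ring
  rw [e1, e2] at hI
  exact (ENNReal.mul_le_mul_iff_right (by simp) (by simp)).1 hI

/-! ### Averaging over dilations -/

section Cone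

variable {E : Type*} [NormedAddCommGroup E] [NormedSpace ℝ E] [FiniteDimensional ℝ E]
  [MeasurableSpace E] [BorelSpace E] (μ : Measure E) [μ.IsAddHaarMeasure]

theorem lintegral_eq_pow_mul_lintegral_comp_smul (h : E → ℝ≥0∞) {l : ℝ} (hl : 0 < l) :
    ∫⁻ w, h w ∂μ = ENNReal.ofReal (l ^ Module.finrank ℝ E) * ∫⁻ u, h (l • u) ∂μ := by
  have hm := (Homeomorph.smulOfNeZero (α := E) l hl.ne').measurableEmbedding.lintegral_map
    (μ := μ) h
  have hp : 0 < l ^ Module.finrank ℝ E := by positivity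
  simp only [Homeomorph.smulOfNeZero_apply] at hm
  rw [← hm]
  change _ = _ * ∫⁻ a, h a ∂(Measure.map (l • ·) μ)
  rw [Measure.map_addHaar_smul μ hl.ne', lintegral_smul_measure, smul_eq_mul, ← mul_assoc,
    ← ENNReal.ofReal_mul hp.le, abs_of_pos (by positivity), mul_inv_cancel₀ hp.ne']
  simp

theorem mul_setLIntegral_le_choose_mul_lintegral {L : Set E} (hL : NullMeasurableSet L μ)
    {g : E → ℝ≥0} (hgm : AEMeasurable g μ) (hg : RadiallyDecreasing g) {k : ℕ} (hk : 1 ≤ k)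
    {S : E → ℝ≥0∞} {b : ℝ≥0∞}
    (hS : ∀ l ∈ Ioo (0 : ℝ) 1, ∀ x ∈ L, ENNReal.ofReal ((1 - l) ^ k) * b ≤ S (l • x)) :
    (∫⁻ x in L, g x ∂μ) * b
      ≤ ((Module.finrank ℝ E + k).choose k : ℝ≥0∞) * ∫⁻ x, g x * S x ∂μ := by
  obtain ⟨j, rfl⟩ : ∃ j, k = j + 1 := ⟨k - 1, by omega⟩
  -- Swapping the integrals needs a measurable set; a subset of `L` keeps `hS` available.
  obtain ⟨U, hUL, hU, hUae⟩ := hL.exists_measurable_subset_ae_eq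
  rw [← setLIntegral_congr hUae]
  set φ : ℝ → ℝ≥0∞ := fun l => ENNReal.ofReal ((j + 1 : ℝ) * (1 - l) ^ j) with hφ
  have hφm : Measurable φ := by fun_prop
  set I : E → ℝ≥0∞ := U.indicator 1 with hI
  have hIm : Measurable I := measurable_one.indicator hU
  -- For fixed `w`, every `l` with `l⁻¹ • w ∈ U` gives a lower bound for `S w`; average them with
  -- weight `φ`.
  have hpt : ∀ w, (g w : ℝ≥0∞) * ((∫⁻ l in Ioo (0 : ℝ) 1, φ l * I (l⁻¹ • w)) * b)
      ≤ g w * S w := by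
    intro w
    gcongr
    have hΛm : MeasurableSet {l : ℝ | l⁻¹ • w ∈ U} :=
      (show Measurable fun l : ℝ => l⁻¹ • w by fun_prop) hU
    have : ∀ l, φ l * I (l⁻¹ • w) = {l : ℝ | l⁻¹ • w ∈ U}.indicator φ l := by
      intro l
      by_cases h : l⁻¹ • w ∈ U <;> simp [hI, h]
    simp_rw [this]
    rw [setLIntegral_indicator hΛm]
    refine setLIntegral_mul_le_of_one_sub_pow_mul_le inter_subset_right j ?_
    rintro l ⟨hl, hl01⟩
    have := hS l hl01 _ (hUL hl)
    rwa [smul_inv_smul₀ hl01.1.ne'] at this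
  have hgm' : AEMeasurable (fun x => (g x : ℝ≥0∞)) μ := hgm.coe_nnreal_ennreal
  have hswap : ∫⁻ w, (g w : ℝ≥0∞) * (∫⁻ l in Ioo (0 : ℝ) 1, φ l * I (l⁻¹ • w)) ∂μ
      = ∫⁻ l in Ioo (0 : ℝ) 1, φ l * ∫⁻ w, g w * I (l⁻¹ • w) ∂μ := by
    have h1 : ∀ w, (g w : ℝ≥0∞) * (∫⁻ l in Ioo (0 : ℝ) 1, φ l * I (l⁻¹ • w))
        = ∫⁻ l in Ioo (0 : ℝ) 1, g w * (φ l * I (l⁻¹ • w)) := fun w =>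
      (lintegral_const_mul' _ _ ENNReal.coe_ne_top).symm
    simp_rw [h1]
    rw [lintegral_lintegral_swap]
    · refine lintegral_congr fun l => ?_
      rw [← lintegral_const_mul' _ _ ENNReal.ofReal_ne_top]
      exact lintegral_congr fun w => by ring
    · have : Measurable fun p : E × ℝ => φ p.2 * I (p.2⁻¹ • p.1) :=
        (hφm.comp measurable_snd).mul (hIm.comp (by fun_prop))
      exact (hgm'.comp_fst).mul this.aemeasurable
  have hscale : ∀ l ∈ Ioo (0 : ℝ) 1,
      ENNReal.ofReal (l ^ Module.finrank ℝ E) * (∫⁻ x in U, g x ∂μ)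
        ≤ ∫⁻ w, g w * I (l⁻¹ • w) ∂μ := by
    intro l hl
    rw [lintegral_eq_pow_mul_lintegral_comp_smul μ _ hl.1, ← lintegral_indicator hU]
    gcongr with u
    rw [inv_smul_smul₀ hl.1.ne']
    by_cases hu : u ∈ U
    · simpa [hI, hu] using hg l ⟨hl.1.le, hl.2.le⟩ u
    · simp [hu]
  set C : ℝ≥0∞ := ((Module.finrank ℝ E + (j + 1)).choose (j + 1) : ℝ≥0∞) with hC
  have hC0 : C ≠ 0 := by
    rw [hC]
    exact_mod_cast (Nat.choose_pos (by omega)).ne'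
  have hCt : C ≠ ⊤ := ENNReal.natCast_ne_top _
  have hfin : C⁻¹ * (∫⁻ x in U, g x ∂μ)
      ≤ ∫⁻ w, (g w : ℝ≥0∞) * (∫⁻ l in Ioo (0 : ℝ) 1, φ l * I (l⁻¹ • w)) ∂μ := by
    rw [hswap, hC, ← lintegral_Ioo_succ_mul_one_sub_pow_mul_pow,
      ← lintegral_mul_const _ (by fun_prop)]
    refine setLIntegral_mono' measurableSet_Ioo fun l hl => ?_
    rw [mul_assoc]
    gcongr
    exact hscale l hl
  calc (∫⁻ x in U, g x ∂μ) * b = C * (C⁻¹ * (∫⁻ x in U, g x ∂μ) * b) := by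
        rw [← mul_assoc, ← mul_assoc, ENNReal.mul_inv_cancel hC0 hCt, one_mul]
    _ ≤ C * ((∫⁻ w, (g w : ℝ≥0∞) * (∫⁻ l in Ioo (0 : ℝ) 1, φ l * I (l⁻¹ • w)) ∂μ) * b) := by
        gcongr
    _ ≤ C * ∫⁻ w, (g w : ℝ≥0∞) * (∫⁻ l in Ioo (0 : ℝ) 1, φ l * I (l⁻¹ • w)) * b ∂μ := by
        gcongr
        exact lintegral_mul_const_le _ _
    _ ≤ C * ∫⁻ x, g x * S x ∂μ := by
        refine mul_le_mul_right (lintegral_mono fun w => ?_) _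
        rw [mul_assoc]
        exact hpt w

end Cone

/-! ### Sections and projections of convex sets -/

theorem measurePreserving_measurableEquivProd_zero {V : Type*} [NormedAddCommGroup V]
    [InnerProductSpace ℝ V] [FiniteDimensional ℝ V] [MeasurableSpace V] [BorelSpace V]
    (H : Submodule ℝ V) : MeasurePreserving (H.measurableEquivProd (0 : V)) := by
  convert! (WithLp.volume_preserving_ofLp H Hᗮ).comp
    H.orthogonalDecomposition.measurePreserving using 1
  ext x <;> simp

section Section

variable {n : ℕ} {H : Submodule ℝ (EuclideanSpace ℝ (Fin n))}
  {K : Set (EuclideanSpace ℝ (Fin n))}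

theorem Convex.section_orthogonal (hK : Convex ℝ K) (x : EuclideanSpace ℝ (Fin n)) :
    Convex ℝ {y : Hᗮ | x + (y : EuclideanSpace ℝ (Fin n)) ∈ K} := by
  have := (hK.translate_preimage_right x).linear_preimage Hᗮ.subtype
  exact this

theorem Convex.setOf_exists_add_mem (hK : Convex ℝ K) :
    Convex ℝ {x : H | ∃ y : Hᗮ,
      (x : EuclideanSpace ℝ (Fin n)) + (y : EuclideanSpace ℝ (Fin n)) ∈ K} := by
  rintro x ⟨y, hy⟩ x' ⟨y', hy'⟩ a b ha hb hab
  refine ⟨a • y + b • y', ?_⟩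
  convert! hK hy hy' ha hb hab using 1
  push_cast
  module

/-- For `x + y ∈ K`, the fibre over `l • x` contains the central fibre scaled by `1 - l` and
translated by `l • y`. -/
theorem Convex.ofReal_pow_mul_sectionVolume_zero_le (hK : Convex ℝ K) {l : ℝ}
    (hl : l ∈ Ioo (0 : ℝ) 1) {x : H} (hx : ∃ y : Hᗮ,
      (x : EuclideanSpace ℝ (Fin n)) + (y : EuclideanSpace ℝ (Fin n)) ∈ K) :
    ENNReal.ofReal ((1 - l) ^ Module.finrank ℝ Hᗮ) * sectionVolume H K 0
      ≤ sectionVolume H K (l • x) := by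
  obtain ⟨y, hy⟩ := hx
  have hl' : 0 < 1 - l := by linarith [hl.2]
  rw [sectionVolume, sectionVolume, ← Measure.addHaar_smul_of_nonneg volume hl'.le]
  refine (measure_mono ?_).trans_eq (measure_preimage_add_right volume (l • y) _)
  rintro _ ⟨z, hz, rfl⟩
  simp only [mem_preimage, mem_ofPred_eq]
  convert! hK hz hy hl'.le hl.1.le (by ring) using 1
  push_cast
  module

theorem Convex.setLIntegral_comp_orthogonalProjectionOnto (hK : Convex ℝ K) {g : H → ℝ≥0}
    (hg : AEMeasurable g volume) :
    ∫⁻ x in K, (g (H.orthogonalProjectionOnto x) : ℝ≥0∞)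
      = ∫⁻ x : H, g x * sectionVolume H K x := by
  have he := measurePreserving_measurableEquivProd_zero H
  have hKm : NullMeasurableSet K volume := hK.nullMeasurableSet volume
  set e := H.measurableEquivProd (0 : EuclideanSpace ℝ (Fin n)) with he_def
  rw [← lintegral_indicator₀ hKm, ← he.symm.lintegral_comp_emb e.symm.measurableEmbedding]
  have h1 : ∀ p : H × Hᗮ, e.symm p = (p.1 : EuclideanSpace ℝ (Fin n)) + p.2 := fun p => by
    simp [he_def]
  have hpt : ∀ p : H × Hᗮ, K.indicator (fun x => (g (H.orthogonalProjectionOnto x) : ℝ≥0∞))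
      (e.symm p) = g p.1 * K.indicator 1 ((p.1 : EuclideanSpace ℝ (Fin n)) + p.2) := by
    rintro ⟨x, y⟩
    have h2 : H.orthogonalProjectionOnto ((x : EuclideanSpace ℝ (Fin n)) + y) = x := by
      rw [map_add, Submodule.orthogonalProjectionOnto_mem_subspace_eq_self,
        (H.orthogonalProjectionOnto_eq_zero_iff).2 y.2, add_zero]
    simp only [h1]
    by_cases h : (x : EuclideanSpace ℝ (Fin n)) + y ∈ K <;> simp [h, h2, -map_add]
  simp_rw [hpt]
  have hKe : AEMeasurable (fun p : H × Hᗮ => (K.indicator 1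
      ((p.1 : EuclideanSpace ℝ (Fin n)) + p.2) : ℝ≥0∞)) volume := by
    have := (aemeasurable_const (b := (1 : ℝ≥0∞))).indicator₀ hKm
    have := this.comp_quasiMeasurePreserving he.symm.quasiMeasurePreserving
    refine this.congr (Filter.Eventually.of_forall fun p => ?_)
    rw [Function.comp_apply, h1]
    rfl
  have hgm : AEMeasurable (fun p : H × Hᗮ => (g p.1 : ℝ≥0∞)) volume :=
    hg.coe_nnreal_ennreal.comp_fst
  rw [Measure.volume_eq_prod, lintegral_prod _ (by exact hgm.mul hKe)]
  refine lintegral_congr fun x => ?_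
  change ∫⁻ y : Hᗮ, (g x : ℝ≥0∞) * K.indicator (1 : EuclideanSpace ℝ (Fin n) → ℝ≥0∞)
    ((x : EuclideanSpace ℝ (Fin n)) + y) = _
  rw [lintegral_const_mul' _ _ ENNReal.coe_ne_top]
  congr 1
  exact lintegral_indicator_one₀ ((hK.section_orthogonal _).nullMeasurableSet volume)

theorem Convex.mul_sectionVolume_zero_le (hK : Convex ℝ K) (hk : 1 ≤ Module.finrank ℝ Hᗮ)
    {g : H → ℝ≥0} (hgm : AEMeasurable g volume) (hg : RadiallyDecreasing g) :
    (∫⁻ x in {x : H | ∃ y : Hᗮ,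
      (x : EuclideanSpace ℝ (Fin n)) + (y : EuclideanSpace ℝ (Fin n)) ∈ K}, (g x : ℝ≥0∞))
        * sectionVolume H K 0
      ≤ (n.choose (Module.finrank ℝ Hᗮ) : ℝ≥0∞)
        * ∫⁻ x in K, (g (H.orthogonalProjectionOnto x) : ℝ≥0∞) := by
  have hn : Module.finrank ℝ H + Module.finrank ℝ Hᗮ = n := by
    rw [Submodule.finrank_add_finrank_orthogonal, finrank_euclideanSpace_fin]
  rw [hK.setLIntegral_comp_orthogonalProjectionOnto hgm]
  have := mul_setLIntegral_le_choose_mul_lintegral (volume : Measure H)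
    ((hK.setOf_exists_add_mem (H := H)).nullMeasurableSet volume) hgm hg hk
    (S := sectionVolume H K) (b := sectionVolume H K 0)
    fun l hl x hx => hK.ofReal_pow_mul_sectionVolume_zero_le hl hx
  rwa [hn] at this

end Section

/-! ### Layer-cake formula and conclusion -/

theorem aemeasurable_of_convex_gt {E : Type*} [NormedAddCommGroup E] [NormedSpace ℝ E]
    [FiniteDimensional ℝ E] [MeasurableSpace E] [BorelSpace E] (μ : Measure E)
    [μ.IsAddHaarMeasure] {f : E → ℝ≥0} (hf : ∀ r, Convex ℝ {x | r < f x}) : AEMeasurable f μ := by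
  refine NullMeasurable.aemeasurable ?_
  have : Measurable (fun x : NullMeasurableSpace E μ => f x) :=
    measurable_of_Ioi fun r => (hf r).nullMeasurableSet μ
  exact this

theorem lintegral_coe_nnreal_eq_lintegral_measure_gt {α : Type*} [MeasurableSpace α]
    (μ : Measure α) {f : α → ℝ≥0} (hf : AEMeasurable f μ) :
    ∫⁻ x, (f x : ℝ≥0∞) ∂μ = ∫⁻ t in Ioi (0 : ℝ), μ {x | t.toNNReal < f x} := by
  have h := lintegral_eq_lintegral_meas_lt μ (f := fun x => (f x : ℝ))
    (Filter.Eventually.of_forall fun x => (f x).coe_nonneg) hf.coe_nnreal_real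
  simp only [ENNReal.ofReal_coe_nnreal] at h
  rw [h]
  refine setLIntegral_congr_fun measurableSet_Ioi fun t ht => ?_
  simp only [Real.toNNReal_lt_iff_lt_coe (le_of_lt ht)]

theorem setLIntegral_Ioi_eq_Ioo_of_ae_le {α : Type*} [MeasurableSpace α]
    (μ : Measure α) {f : α → ℝ≥0} {M : ℝ≥0} (hf : ∀ᵐ x ∂μ, f x ≤ M) :
    ∫⁻ t in Ioi (0 : ℝ), μ {x | t.toNNReal < f x}
      = ∫⁻ t in Ioo (0 : ℝ) M, μ {x | t.toNNReal < f x} := by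
  rw [← lintegral_indicator measurableSet_Ioi, ← lintegral_indicator measurableSet_Ioo]
  refine lintegral_congr fun t => ?_
  by_cases ht : t ∈ Ioo (0 : ℝ) M
  · rw [indicator_of_mem ht, indicator_of_mem (Ioo_subset_Ioi_self ht)]
  rw [indicator_of_notMem ht, indicator_apply_eq_zero]
  intro ht0
  have hMt : M ≤ t.toNNReal := by
    refine NNReal.le_toNNReal_of_coe_le ?_
    by_contra h
    exact ht ⟨ht0, not_le.1 h⟩
  refine measure_mono_null (fun x hx => ?_) (ae_iff.1 hf)
  exact not_le.2 (hMt.trans_lt hx)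

theorem theoremt (n k : ℕ) (hk : 1 ≤ k) (hkn : k < n)
    (H : Submodule ℝ (EuclideanSpace ℝ (Fin n))) (hH : Module.finrank ℝ H = n - k)
    (f : EuclideanSpace ℝ (Fin n) → ℝ≥0) (hf_bdd : BddAbove (range f))
    (hf_qc : QuasiconcaveOn ℝ univ f)
    (hf_sec : ∀ t ∈ Ioo (0 : ℝ) 1, ∀ x : H,
      sectionVolume H (superlevel f t) x ≤ sectionVolume H (superlevel f t) 0)
    (hf_perp : ∀ᵐ y : Hᗮ, f y ≤ supNorm f)
    (hf_proj : ∀ᵐ x : H, projFun H f x ≤ supNorm f)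
    (g : H → ℝ≥0) (hg_meas : AEMeasurable g volume) (hg : RadiallyDecreasing g) :
    (∫⁻ x : H, (g x : ℝ≥0∞) * (projFun H f x : ℝ≥0∞)) * (∫⁻ y : Hᗮ, (f y : ℝ≥0∞))
      ≤ (n.choose k : ℝ≥0∞) * (supNorm f : ℝ≥0∞)
        * ∫⁻ x : EuclideanSpace ℝ (Fin n),
            (g (H.orthogonalProjectionOnto x) : ℝ≥0∞) * (f x : ℝ≥0∞) := by
  have hperp : Module.finrank ℝ Hᗮ = k := by
    have := H.finrank_add_finrank_orthogonal
    rw [finrank_euclideanSpace_fin] at this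
    omega
  have hK : ∀ r, Convex ℝ {x | r < f x} := fun r => by simpa using hf_qc.convex_gt r
  have hproj : ∀ (r : ℝ≥0), {x : H | r < projFun H f x} = {x : H | ∃ y : Hᗮ,
      (x : EuclideanSpace ℝ (Fin n)) + (y : EuclideanSpace ℝ (Fin n)) ∈ {x | r < f x}} := by
    intro r
    ext x
    exact lt_ciSup_iff (hf_bdd.mono (by rintro _ ⟨y, rfl⟩; exact mem_range_self _))
  have hfm : AEMeasurable f volume := aemeasurable_of_convex_gt _ hK
  have hfm' : AEMeasurable (fun y : Hᗮ => f y) volume :=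
    aemeasurable_of_convex_gt _ fun r => (hK r).linear_preimage Hᗮ.subtype
  have hPconv : ∀ r, Convex ℝ {x : H | r < projFun H f x} := fun r => by
    rw [hproj]
    exact (hK r).setOf_exists_add_mem
  have hPm : AEMeasurable (projFun H f) volume := aemeasurable_of_convex_gt _ hPconv
  have hg' : AEMeasurable (fun x => (g x : ℝ≥0∞)) volume := hg_meas.coe_nnreal_ennreal
  have hgP : AEMeasurable (fun x => (g (H.orthogonalProjectionOnto x) : ℝ≥0∞)) volume := by
    have := (hg'.comp_fst (ν := (volume : Measure Hᗮ))).comp_quasiMeasurePreserving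
      (measurePreserving_measurableEquivProd_zero H).quasiMeasurePreserving
    refine this.congr (Filter.Eventually.of_forall fun x => ?_)
    simp
  set M := supNorm f
  -- Absorbing `g` into the measures lets the layer-cake formula slice only `projFun H f` and `f`.
  set μ : Measure H := volume.withDensity fun x => (g x : ℝ≥0∞) with hμ
  set ν : Measure (EuclideanSpace ℝ (Fin n)) :=
    volume.withDensity fun x => (g (H.orthogonalProjectionOnto x) : ℝ≥0∞) with hν
  have hμac : μ ≪ volume := withDensity_absolutelyContinuous _ _
  have hνac : ν ≪ volume := withDensity_absolutelyContinuous _ _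
  have e1 : ∫⁻ x : H, (g x : ℝ≥0∞) * (projFun H f x : ℝ≥0∞)
      = ∫⁻ t in Ioo (0 : ℝ) M, μ {x | t.toNNReal < projFun H f x} := by
    rw [← setLIntegral_Ioi_eq_Ioo_of_ae_le μ (hμac.ae_le hf_proj),
      ← lintegral_coe_nnreal_eq_lintegral_measure_gt μ (hPm.mono_ac hμac), hμ,
      lintegral_withDensity_eq_lintegral_mul₀ hg' hPm.coe_nnreal_ennreal]
    rfl
  have e2 : ∫⁻ y : Hᗮ, (f y : ℝ≥0∞)
      = ∫⁻ t in Ioo (0 : ℝ) M, volume {y : Hᗮ | t.toNNReal < f y} := by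
    rw [← setLIntegral_Ioi_eq_Ioo_of_ae_le volume hf_perp,
      ← lintegral_coe_nnreal_eq_lintegral_measure_gt volume hfm']
  have e3 : ∫⁻ x : EuclideanSpace ℝ (Fin n),
      (g (H.orthogonalProjectionOnto x) : ℝ≥0∞) * (f x : ℝ≥0∞)
      = ∫⁻ t in Ioi (0 : ℝ), ν {x | t.toNNReal < f x} := by
    rw [← lintegral_coe_nnreal_eq_lintegral_measure_gt ν (hfm.mono_ac hνac), hν,
      lintegral_withDensity_eq_lintegral_mul₀ hgP hfm.coe_nnreal_ennreal]
    rfl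
  have hlevel : ∀ r : ℝ≥0, μ {x | r < projFun H f x} * volume {y : Hᗮ | r < f y}
      ≤ (n.choose k : ℝ≥0∞) * ν {x | r < f x} := by
    intro r
    have := (hK r).mul_sectionVolume_zero_le (H := H) (by omega) hg_meas hg
    rw [← hproj, hperp] at this
    rw [hμ, hν, withDensity_apply', withDensity_apply']
    simpa [sectionVolume] using this
  have hanti : ∀ {α : Type} [MeasurableSpace α] (ρ : Measure α) (h : α → ℝ≥0),
      Antitone fun t : ℝ => ρ {x | t.toNNReal < h x} := fun ρ h s t hst =>
    measure_mono fun x hx => lt_of_le_of_lt (Real.toNNReal_mono hst) hx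
  rw [e1, e2, e3]
  refine (lintegral_mul_lintegral_le_of_antitone (hanti _ _) (hanti _ _) _).trans ?_
  rw [Real.volume_Ioo, sub_zero, ENNReal.ofReal_coe_nnreal, mul_comm (n.choose k : ℝ≥0∞), mul_assoc]
  gcongr
  rw [← lintegral_const_mul' _ _ (ENNReal.natCast_ne_top _)]
  -- Only the left-hand integrals had to be cut off at `M`; on the right the range may simply grow.
  exact (lintegral_mono fun t => hlevel _).trans (lintegral_mono_set Ioo_subset_Ioi_self)
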